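/- All graphs are finite, undirected, without loops or parallel edges. A \emph{2-matching} in a graph $G=(VG,EG)$ is a function $x\colon EG\to\{0,1,2\}$ such that for every node $v$ the sum of $x(e)$ over all edges $e$ incident to $v$ is at most $2$; its \emph{size} is $\sum_{e\in EG}x(e)$. It is \emph{triangle-free} if $\{e\in EG : x(e)\neq 0\}$ contains no triangle, and \emph{basic} if $\{e\in EG : x(e)=1\}$ partitions into a collection of node-disjoint circuits of odd length. **Theorem.** Let $d\ge 3$, and let $G$ be a graph on $n$ nodes of which $n-q$ have degree $d$ and the remaining $q$ have degree $d-1$. Then there exists a basic triangle-free 2-matching in $G$ of size at least $n-q/d$. -/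

import Mathlib

namespace SimpleGraph

/-- `x` is a 2-matching of `G`: a function `EG → {0, 1, 2}`, extended by `0` to all unordered pairs,
whose values on the edges incident to any given node sum to at most `2`. -/
structure IsTwoMatching {V : Type*} [Fintype V] [DecidableEq V] (G : SimpleGraph V)
    [DecidableRel G.Adj] (x : Sym2 V → ℕ) : Prop where
  eq_zero_of_notMem : ∀ e, e ∉ G.edgeSet → x e = 0
  le_two : ∀ e ∈ G.edgeSet, x e ≤ 2
  sum_incident_le_two : ∀ v : V, ∑ e ∈ G.incidenceFinset v, x e ≤ 2

/-- The size of `x`: the sum of `x e` over the edges `e` of `G`. -/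
def twoMatchingSize {V : Type*} [Fintype V] [DecidableEq V] (G : SimpleGraph V)
    [DecidableRel G.Adj] (x : Sym2 V → ℕ) : ℕ :=
  ∑ e ∈ G.edgeFinset, x e

/-- The support of `x`: the set of edges `e` of `G` with `x e ≠ 0`. -/
def twoMatchingSupport {V : Type*} (G : SimpleGraph V) (x : Sym2 V → ℕ) : Set (Sym2 V) :=
  {e | e ∈ G.edgeSet ∧ x e ≠ 0}

/-- `x` is triangle-free: its support contains no triangle. -/
def IsTriangleFreeTwoMatching {V : Type*} (G : SimpleGraph V) (x : Sym2 V → ℕ) : Prop :=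
  (SimpleGraph.fromEdgeSet (G.twoMatchingSupport x)).CliqueFree 3

/-- `x` is basic: the set of edges `e` with `x e = 1` partitions into a collection of
node-disjoint circuits of odd length. -/
def IsBasicTwoMatching {V : Type*} (G : SimpleGraph V) (x : Sym2 V → ℕ) : Prop :=
  ∃ C : Set (Σ v : V, G.Walk v v),
    (∀ c ∈ C, c.2.IsCycle ∧ Odd c.2.length) ∧
    (∀ c ∈ C, ∀ c' ∈ C, c ≠ c' → ∀ v, ¬ (v ∈ c.2.support ∧ v ∈ c'.2.support)) ∧
    (∀ e ∈ G.edgeSet, x e = 1 ↔ ∃ c ∈ C, e ∈ c.2.edges)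

end SimpleGraph

/-! Give weight 2 to the edges and weight 1 to the edges of the odd cycles in a disjoint family of
edges and odd cycles of length at least five. This is a basic triangle-free 2-matching whose size is
the number of covered nodes, so it suffices to leave at most `q / d` nodes uncovered.

A Gallai–Edmonds type barrier (`exists_isBarrier`) splits the nodes into a set `S`, factor-critical
pieces with no edges between them, and a perfectly matched rest; moreover `S` can be matched into
distinct pieces. A piece matched to a node of `S` is covered together with it, and an unmatched
piece is lost by at most one node, by none if it is packable.

An unpackable factor-critical piece `K` is sparse: each edge lies in a triangle that every
near-perfect matching uses, so `K` has at most `3 (|K| - 1) / 2` edges (`sum_card_filter_adj_le`).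
As `d ≥ 3`, it sends at least `d` edges to `S`, up to one for each node of degree `d - 1`. Since
nodes of `S` have degree at most `d`, Hall's theorem matches all but `q / d` unpackable pieces into
`S`. The Mendelsohn–Dulmage theorem combines this with the matching covering `S`. -/

namespace SimpleGraph

/-! ### Packable node sets and the 2-matchings they carry -/

/-- `W` is the node set of a family of disjoint edges and odd cycles of length at least five. -/
inductive IsPackable {V : Type*} [DecidableEq V] (G : SimpleGraph V) : Finset V → Prop
  | empty : G.IsPackable ∅
  | edge {W : Finset V} {u v : V} (h : G.Adj u v) (hd : Disjoint {u, v} W) :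
      G.IsPackable W → G.IsPackable ({u, v} ∪ W)
  | cycle {W : Finset V} {v : V} (c : G.Walk v v) (hc : c.IsCycle) (ho : Odd c.length)
      (h5 : 5 ≤ c.length) (hd : Disjoint c.support.toFinset W) :
      G.IsPackable W → G.IsPackable (c.support.toFinset ∪ W)

/-- `x` is a basic triangle-free 2-matching of size `|W|` living on the node set `W`. -/
structure IsBasicPacking {V : Type*} [Fintype V] [DecidableEq V] (G : SimpleGraph V)
    [DecidableRel G.Adj] (x : Sym2 V → ℕ) (W : Finset V) : Prop where
  mem_edgeSet : ∀ e, x e ≠ 0 → e ∈ G.edgeSet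
  mem : ∀ e, x e ≠ 0 → ∀ v ∈ e, v ∈ W
  le_two : ∀ e, x e ≤ 2
  incident : ∀ v : V, ∑ e ∈ G.incidenceFinset v, x e ≤ 2
  size : G.twoMatchingSize x = W.card
  triangle : ∀ a b c, a ≠ b → a ≠ c → b ≠ c → x s(a, b) ≠ 0 → x s(a, c) ≠ 0 →
    x s(b, c) ≠ 0 → False
  basic : ∃ C : Set (Σ v : V, G.Walk v v),
    (∀ c ∈ C, c.2.IsCycle ∧ Odd c.2.length) ∧
    (∀ c ∈ C, ∀ c' ∈ C, c ≠ c' → ∀ v, ¬ (v ∈ c.2.support ∧ v ∈ c'.2.support)) ∧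
    (∀ e ∈ G.edgeSet, x e = 1 ↔ ∃ c ∈ C, e ∈ c.2.edges) ∧
    ∀ c ∈ C, ∀ v ∈ c.2.support, v ∈ W

section

variable {V : Type*} [DecidableEq V] {G : SimpleGraph V}

theorem Walk.mem_of_mem_support_of_closed {V : Type*} {G : SimpleGraph V} {T : Set V} {u v : V} (p : G.Walk u v) (hu : u ∈ T)
    (h : ∀ a b, a ∈ T → s(a, b) ∈ p.edges → b ∈ T) : ∀ w ∈ p.support, w ∈ T := by
  induction p with
  | nil => intro w hw; simp at hw; rwa [hw]
  | cons hadj p ih =>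
    intro w hw
    rw [Walk.support_cons, List.mem_cons] at hw
    rcases hw with rfl | hw
    · exact hu
    · refine ih (h _ _ hu (by simp)) (fun a b ha hab => h a b ha ?_) w hw
      rw [Walk.edges_cons]
      exact List.mem_cons_of_mem _ hab

theorem Walk.IsCycle.card_support {v : V} {c : G.Walk v v} (hc : c.IsCycle) :
    c.support.toFinset.card = c.length := by
  have h : c.support.toFinset = c.support.tail.toFinset := by
    ext w
    rw [List.mem_toFinset, List.mem_toFinset, c.mem_support_iff, or_iff_right_of_imp]
    rintro rfl
    exact Walk.end_mem_tail_support hc.not_nil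
  rw [h, List.toFinset_card_of_nodup hc.support_nodup, List.length_tail, Walk.length_support]
  rfl

/-- Each node of a cycle has exactly two neighbours along it, so `{a, b, c}` is closed under
adjacency in the cycle and contains all its nodes. This keeps the supports of the longer cycles
triangle-free. -/
theorem Walk.IsCycle.length_le_three {v : V} {p : G.Walk v v} (hp : p.IsCycle) {a b c : V}
    (hab : a ≠ b) (hac : a ≠ c) (hbc : b ≠ c) (h1 : s(a, b) ∈ p.edges) (h2 : s(a, c) ∈ p.edges)
    (h3 : s(b, c) ∈ p.edges) : p.length ≤ 3 := by
  have key : ∀ x y z w : V, y ≠ z → s(x, y) ∈ p.edges → s(x, z) ∈ p.edges →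
      s(x, w) ∈ p.edges → w = y ∨ w = z := by
    intro x y z w hyz hy hz hw
    have hcard := hp.ncard_neighborSet_toSubgraph_eq_two (p.fst_mem_support_of_mem_edges hy)
    have hsub : ({y, z} : Set V) ⊆ p.toSubgraph.neighborSet x := by
      rintro t (rfl | rfl) <;>
        simpa [Subgraph.mem_neighborSet, Walk.adj_toSubgraph_iff_mem_edges]
    have heq := Set.eq_of_subset_of_ncard_le hsub (by rw [hcard, Set.ncard_pair hyz])
      p.finite_neighborSet_toSubgraph
    have : w ∈ p.toSubgraph.neighborSet x := by
      simpa [Subgraph.mem_neighborSet, Walk.adj_toSubgraph_iff_mem_edges]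
    rw [← heq] at this
    simpa using this
  have ha : a ∈ p.support := p.fst_mem_support_of_mem_edges h1
  have hrot : ∀ e, e ∈ (p.rotate a ha).edges ↔ e ∈ p.edges := fun e =>
    (p.rotate_edges a ha).mem_iff
  have hsupp : (p.rotate a ha).support.toFinset ⊆ {a, b, c} := by
    intro w hw
    have := (p.rotate a ha).mem_of_mem_support_of_closed (T := {a, b, c}) (by simp) (by
      intro x y hx hxy
      rw [hrot] at hxy
      have h1' := h1
      have h2' := h2
      have h3' := h3
      rw [Sym2.eq_swap] at h1' h2' h3'
      rcases hx with rfl | rfl | rfl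
      · rcases key _ _ _ _ hbc h1 h2 hxy with rfl | rfl <;> simp
      · rcases key _ _ _ _ hac h1' h3 hxy with rfl | rfl <;> simp
      · rcases key _ _ _ _ hab h2' h3' hxy with rfl | rfl <;> simp) w (by simpa using hw)
    simpa using this
  have := Finset.card_le_card hsupp
  rw [(hp.rotate ha).card_support, Walk.length_rotate] at this
  exact this.trans Finset.card_le_three

theorem IsPackable.union {W W' : Finset V} (h : G.IsPackable W) (h' : G.IsPackable W')
    (hd : Disjoint W W') : G.IsPackable (W ∪ W') := by
  induction h with
  | empty => simpa
  | edge hadj hd1 _ ih =>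
    rw [Finset.disjoint_union_left] at hd
    rw [Finset.union_assoc]
    exact .edge hadj (Finset.disjoint_union_right.2 ⟨hd1, hd.1⟩) (ih hd.2)
  | cycle c hc ho h5 hd1 _ ih =>
    rw [Finset.disjoint_union_left] at hd
    rw [Finset.union_assoc]
    exact .cycle c hc ho h5 (Finset.disjoint_union_right.2 ⟨hd1, hd.1⟩) (ih hd.2)

theorem IsPackable.of_adj {u v : V} (h : G.Adj u v) : G.IsPackable {u, v} := by
  simpa using IsPackable.edge h (Finset.disjoint_empty_right _) .empty

theorem IsPackable.of_cycle {v : V} {c : G.Walk v v} (hc : c.IsCycle) (ho : Odd c.length)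
    (h5 : 5 ≤ c.length) : G.IsPackable c.support.toFinset := by
  simpa using IsPackable.cycle c hc ho h5 (Finset.disjoint_empty_right _) .empty

theorem IsPackable.biUnion {ι : Type*} (s : Finset ι) (f : ι → Finset V)
    (h : ∀ i ∈ s, G.IsPackable (f i))
    (hd : ∀ i ∈ s, ∀ j ∈ s, i ≠ j → Disjoint (f i) (f j)) : G.IsPackable (s.biUnion f) := by
  classical
  induction s using Finset.induction_on with
  | empty => simpa using IsPackable.empty
  | insert a s ha ih =>
    rw [Finset.biUnion_insert]
    refine (h a (by simp)).union (ih (fun i hi => h i (by simp [hi]))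
      fun i hi j hj => hd i (by simp [hi]) j (by simp [hj])) ?_
    rw [Finset.disjoint_biUnion_right]
    intro i hi
    exact hd a (by simp) i (by simp [hi]) (by rintro rfl; exact ha hi)

end

section

variable {V : Type*} [Fintype V] [DecidableEq V] {G : SimpleGraph V} [DecidableRel G.Adj]

/-- Since the node sets are disjoint, at most one summand is nonzero on any edge, and each condition
is inherited from that summand. The circuits stay node-disjoint because each collection is confined
to its own node set. -/
theorem IsBasicPacking.add {x y : Sym2 V → ℕ} {W W' : Finset V} (hx : G.IsBasicPacking x W)
    (hy : G.IsBasicPacking y W') (hd : Disjoint W W') :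
    G.IsBasicPacking (fun e => x e + y e) (W ∪ W') := by
  have hW : ∀ v, v ∈ W → v ∉ W' := fun v h h' => Finset.disjoint_left.1 hd h h'
  have hxz : ∀ v e, v ∉ W → v ∈ e → x e = 0 := fun v e hv he => by
    by_contra h; exact hv (hx.mem e h v he)
  have hyz : ∀ v e, v ∉ W' → v ∈ e → y e = 0 := fun v e hv he => by
    by_contra h; exact hv (hy.mem e h v he)
  have hor : ∀ e, x e = 0 ∨ y e = 0 := by
    intro e
    induction e with
    | _ a b =>
      by_cases ha : a ∈ W
      · exact .inr (hyz a _ (hW a ha) (by simp))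
      · exact .inl (hxz a _ ha (by simp))
  obtain ⟨C, hC1, hC2, hC3, hC4⟩ := hx.basic
  obtain ⟨D, hD1, hD2, hD3, hD4⟩ := hy.basic
  refine ⟨?_, ?_, ?_, ?_, ?_, ?_, C ∪ D, ?_, ?_, ?_, ?_⟩
  · intro e he
    rcases hor e with h | h
    · exact hy.mem_edgeSet e (by simpa [h] using he)
    · exact hx.mem_edgeSet e (by simpa [h] using he)
  · intro e he v hv
    rcases hor e with h | h
    · exact Finset.mem_union_right _ (hy.mem e (by simpa [h] using he) v hv)
    · exact Finset.mem_union_left _ (hx.mem e (by simpa [h] using he) v hv)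
  · intro e
    have := hx.le_two e
    have := hy.le_two e
    rcases hor e with h | h <;> simpa [h]
  · intro v
    rw [Finset.sum_add_distrib]
    by_cases hv : v ∈ W
    · rw [Finset.sum_eq_zero (f := y)]
      · simpa using hx.incident v
      · intro e he
        exact hyz v e (hW v hv) ((G.mem_incidenceFinset v e).1 he).2
    · rw [Finset.sum_eq_zero (f := x)]
      · simpa using hy.incident v
      · intro e he
        exact hxz v e hv ((G.mem_incidenceFinset v e).1 he).2
  · rw [Finset.card_union_of_disjoint hd, ← hx.size, ← hy.size]
    exact Finset.sum_add_distrib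
  · intro a b c hab hac hbc h1 h2 h3
    by_cases ha : a ∈ W
    · have h1' := hyz a s(a, b) (hW a ha) (by simp)
      have h2' := hyz a s(a, c) (hW a ha) (by simp)
      have hb := hx.mem s(a, b) (by simpa [h1'] using h1) b (by simp)
      have h3' := hyz b s(b, c) (hW b hb) (by simp)
      simp only [h1', h2', h3', add_zero] at h1 h2 h3
      exact hx.triangle a b c hab hac hbc h1 h2 h3
    · have h1' := hxz a s(a, b) ha (by simp)
      have h2' := hxz a s(a, c) ha (by simp)
      have hb := hy.mem s(a, b) (by simpa [h1'] using h1) b (by simp)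
      have h3' := hxz b s(b, c) (fun h => hW b h hb) (by simp)
      simp only [h1', h2', h3', zero_add] at h1 h2 h3
      exact hy.triangle a b c hab hac hbc h1 h2 h3
  · rintro c (hc | hc)
    · exact hC1 c hc
    · exact hD1 c hc
  · rintro c (hc | hc) c' (hc' | hc') hne v ⟨hv, hv'⟩
    · exact hC2 c hc c' hc' hne v ⟨hv, hv'⟩
    · exact hW v (hC4 c hc v hv) (hD4 c' hc' v hv')
    · exact hW v (hC4 c' hc' v hv') (hD4 c hc v hv)
    · exact hD2 c hc c' hc' hne v ⟨hv, hv'⟩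
  · intro e he
    have h1 := hC3 e he
    have h2 := hD3 e he
    have : x e + y e = 1 ↔ x e = 1 ∨ y e = 1 := by
      rcases hor e with h | h <;> simp [h]
    rw [this, h1, h2]
    constructor
    · rintro (⟨c, hc, h⟩ | ⟨c, hc, h⟩)
      · exact ⟨c, .inl hc, h⟩
      · exact ⟨c, .inr hc, h⟩
    · rintro ⟨c, hc | hc, h⟩
      · exact .inl ⟨c, hc, h⟩
      · exact .inr ⟨c, hc, h⟩
  · rintro c (hc | hc) v hv
    · exact Finset.mem_union_left _ (hC4 c hc v hv)
    · exact Finset.mem_union_right _ (hD4 c hc v hv)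

theorem IsBasicPacking.zero : G.IsBasicPacking (fun _ => 0) ∅ where
  mem_edgeSet := by simp
  mem := by simp
  le_two := by simp
  incident := by simp
  size := by simp [twoMatchingSize]
  triangle := by simp
  basic := ⟨∅, by simp⟩

theorem IsBasicPacking.of_adj {u v : V} (h : G.Adj u v) :
    G.IsBasicPacking (fun e => if e = s(u, v) then 2 else 0) {u, v} where
  mem_edgeSet := by
    intro e he
    obtain rfl : e = s(u, v) := by by_contra h; simp [h] at he
    exact h
  mem := by
    intro e he w hw
    obtain rfl : e = s(u, v) := by by_contra h; simp [h] at he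
    simpa using hw
  le_two := by intro e; split_ifs <;> simp
  incident := by
    intro w
    rw [Finset.sum_ite_eq']
    split_ifs <;> simp
  size := by
    rw [twoMatchingSize, Finset.sum_ite_eq', if_pos (by simpa using h),
      Finset.card_pair h.ne]
  triangle := by
    intro a b c hab hac hbc h1 h2 h3
    simp only [ne_eq, ite_eq_right_iff, OfNat.ofNat_ne_zero, imp_false, not_not] at h1 h2 h3
    rw [← h1] at h2
    have : c ∈ s(a, b) := by rw [← h2]; simp
    rcases Sym2.mem_iff.1 this with h | h
    · exact hac h.symm
    · exact hbc h.symm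
  basic := by
    refine ⟨∅, by simp, by simp, ?_, by simp⟩
    intro e _
    by_cases h : e = s(u, v) <;> simp [h]

theorem IsBasicPacking.of_cycle {v : V} {c : G.Walk v v} (hc : c.IsCycle) (ho : Odd c.length)
    (h5 : 5 ≤ c.length) :
    G.IsBasicPacking (fun e => if e ∈ c.edges then 1 else 0) c.support.toFinset where
  mem_edgeSet := by
    intro e he
    refine c.edges_subset_edgeSet ?_
    by_contra h
    simp [h] at he
  mem := by
    intro e he w hw
    have he' : e ∈ c.edges := by by_contra h; simp [h] at he
    exact List.mem_toFinset.2 (c.mem_support_of_mem_edges he' hw)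
  le_two := by intro e; split_ifs <;> simp
  incident := by
    intro w
    rw [← Finset.card_filter]
    by_cases hw : w ∈ c.support
    · rw [← hc.ncard_neighborSet_toSubgraph_eq_two hw, ← Set.ncard_coe_finset]
      refine le_trans (Set.ncard_le_ncard (t := (fun z => s(w, z)) ''
        c.toSubgraph.neighborSet w) ?_ (Set.toFinite _)) (Set.ncard_image_le (Set.toFinite _))
      intro e he
      rw [Finset.mem_coe, Finset.mem_filter, mem_incidenceFinset] at he
      obtain ⟨z, rfl⟩ := he.1.2
      exact ⟨z, by simpa [Walk.adj_toSubgraph_iff_mem_edges] using he.2, rfl⟩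
    · rw [Finset.filter_false_of_mem]
      · simp
      · intro e he hec
        exact hw (c.mem_support_of_mem_edges hec ((G.mem_incidenceFinset w e).1 he).2)
  size := by
    rw [twoMatchingSize, ← Finset.card_filter, hc.card_support, ← c.length_edges,
      ← List.toFinset_card_of_nodup hc.edges_nodup]
    congr 1
    ext e
    simp only [Finset.mem_filter, mem_edgeFinset, List.mem_toFinset, and_iff_right_iff_imp]
    exact fun h => c.edges_subset_edgeSet h
  triangle := by
    intro a b d hab hac hbc h1 h2 h3
    simp only [ne_eq, ite_eq_right_iff, one_ne_zero, imp_false, not_not] at h1 h2 h3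
    have := hc.length_le_three hab hac hbc h1 h2 h3
    omega
  basic := by
    refine ⟨{⟨v, c⟩}, ?_, ?_, ?_, ?_⟩
    · rintro _ rfl
      exact ⟨hc, ho⟩
    · rintro _ rfl _ rfl h
      exact (h rfl).elim
    · intro e _
      simp
    · rintro _ rfl w hw
      exact List.mem_toFinset.2 hw

theorem IsPackable.exists_isBasicPacking {W : Finset V} (h : G.IsPackable W) :
    ∃ x, G.IsBasicPacking x W := by
  induction h with
  | empty => exact ⟨_, .zero⟩
  | edge hadj hd _ ih =>
    obtain ⟨y, hy⟩ := ih
    exact ⟨_, (IsBasicPacking.of_adj hadj).add hy hd⟩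
  | cycle c hc ho h5 hd _ ih =>
    obtain ⟨y, hy⟩ := ih
    exact ⟨_, (IsBasicPacking.of_cycle hc ho h5).add hy hd⟩

theorem IsPackable.exists_twoMatching {W : Finset V} (h : G.IsPackable W) :
    ∃ x : Sym2 V → ℕ, G.IsTwoMatching x ∧ G.IsBasicTwoMatching x ∧
      G.IsTriangleFreeTwoMatching x ∧ G.twoMatchingSize x = W.card := by
  obtain ⟨x, hx⟩ := h.exists_isBasicPacking
  refine ⟨x, ⟨?_, fun e _ => hx.le_two e, hx.incident⟩, ?_, ?_, hx.size⟩
  · intro e he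
    by_contra h0
    exact he (hx.mem_edgeSet e h0)
  · obtain ⟨C, h1, h2, h3, -⟩ := hx.basic
    exact ⟨C, h1, h2, h3⟩
  · intro s hs
    obtain ⟨a, b, c, hab, hac, hbc, -⟩ := is3Clique_iff.1 hs
    rw [fromEdgeSet_adj] at hab hac hbc
    exact hx.triangle a b c hab.2 hac.2 hbc.2 hab.1.2 hac.1.2 hbc.1.2

end

end SimpleGraph

/-! ### Unpackable factor-critical sets are sparse -/

namespace SimpleGraph

/-- `m` restricts to a perfect matching of the subgraph induced by `W`. -/
def Matches {V : Type*} (G : SimpleGraph V) (m : V → V) (W : Finset V) : Prop :=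
  ∀ v ∈ W, m v ∈ W ∧ G.Adj v (m v) ∧ m (m v) = v

/-- `a b c` is a triangle in `C` such that every matching of `C` missing exactly one of its nodes
joins the other two. -/
structure IsTightTriangle {V : Type*} [DecidableEq V] (G : SimpleGraph V) (C : Finset V)
    (a b c : V) : Prop where
  mem : c ∈ C
  matched_left : ∀ m, G.Matches m (C.erase a) → m b = c
  matched_mid : ∀ m, G.Matches m (C.erase b) → m c = a
  matched_right : ∀ m, G.Matches m (C.erase c) → m a = b
  adj_left : G.Adj a b
  adj_mid : G.Adj b c
  adj_right : G.Adj c a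

/-- The matching `m` missing `r` uses an edge of the triangle `a b c`. -/
def Hits {V : Type*} (m : V → V) (r a b c : V) : Prop :=
  (a ≠ r ∧ m a = b) ∨ (b ≠ r ∧ m b = c) ∨ (c ≠ r ∧ m c = a)

section

variable {V : Type*} [DecidableEq V] {G : SimpleGraph V}

theorem Matches.sdiff_pair {m : V → V} {W : Finset V} (h : G.Matches m W) {v : V} (hv : v ∈ W) :
    G.Matches m (W \ {v, m v}) := by
  intro w hw
  simp only [Finset.mem_sdiff, Finset.mem_insert, Finset.mem_singleton, not_or] at hw ⊢
  obtain ⟨h1, h2, h3⟩ := h w hw.1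
  refine ⟨⟨h1, ?_, ?_⟩, h2, h3⟩
  · rintro rfl
    exact hw.2.2 h3.symm
  · intro h4
    have := congrArg m h4
    rw [h3, (h v hv).2.2] at this
    exact hw.2.1 this

theorem Matches.induction {P : Finset V → Prop} (h0 : P ∅)
    (h1 : ∀ u v W, G.Adj u v → Disjoint {u, v} W → P W → P ({u, v} ∪ W)) {m : V → V}
    {W : Finset V} (h : G.Matches m W) : P W := by
  induction W using Finset.strongInduction with
  | H W ih =>
    rcases W.eq_empty_or_nonempty with rfl | ⟨v, hv⟩
    · exact h0
    · have hsub : ({v, m v} : Finset V) ⊆ W := by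
        intro w hw
        rcases Finset.mem_insert.1 hw with rfl | hw
        · exact hv
        · rw [Finset.mem_singleton.1 hw]
          exact (h v hv).1
      rw [← Finset.union_sdiff_of_subset hsub]
      exact h1 v (m v) _ (h v hv).2.1 Finset.disjoint_sdiff
        (ih _ (Finset.sdiff_ssubset hsub ⟨v, by simp⟩) (h.sdiff_pair hv))

theorem Matches.isPackable {m : V → V} {W : Finset V} (h : G.Matches m W) : G.IsPackable W :=
  h.induction .empty fun _ _ _ hadj hd hW => .edge hadj hd hW

theorem Matches.even_card {m : V → V} {W : Finset V} (h : G.Matches m W) : Even W.card := by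
  refine h.induction (P := fun W => Even W.card) (by simp) fun u v W hadj hd hW => ?_
  rw [Finset.card_union_of_disjoint hd, Finset.card_pair hadj.ne]
  exact even_two.add hW

/-- Extending an alternating path from `v` until it reaches `w`. -/
theorem isPackable_of_alternating {C : Finset V} {v w : V} {m m' : V → V}
    (hadj : G.Adj v w) (hne : m (m' v) ≠ w) {x : V} (p : G.Walk v x) (hp : p.IsPath)
    (heven : Even p.length) (hpC : p.support.toFinset ⊆ C)
    (hm : G.Matches m (C \ p.support.toFinset))
    (hm' : G.Matches m' ((insert x (C \ p.support.toFinset)).erase w))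
    (hw : x ≠ w → w ∈ C \ p.support.toFinset) (hlen : x = w → 4 ≤ p.length) :
    G.IsPackable C := by
  -- Induction on the set `D` of nodes off the path; each round appends an edge of `m'` and then an
  -- edge of `m`.
  generalize hD : C \ p.support.toFinset = D at *
  induction D using Finset.strongInduction generalizing x with
  | H D ih =>
    have hxD : x ∉ D := by rw [← hD]; simp
    by_cases hx : x = w
    -- The path has arrived at `w`: the edge `v w` closes it to an odd cycle, and `m` matches
    -- everything else.
    · subst hx
      have hcyc : (Walk.cons hadj.symm p).IsCycle := by
        rw [Walk.cons_isCycle_iff]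
        refine ⟨hp, fun h => ?_⟩
        have := hp.length_eq_one_of_mem_edges (Sym2.eq_swap ▸ h)
        have := hlen rfl
        omega
      have hsupp : (Walk.cons hadj.symm p).support.toFinset = p.support.toFinset := by
        rw [Walk.support_cons, List.toFinset_cons, Finset.insert_eq_self]
        simp
      have hpack := (IsPackable.of_cycle hcyc (by
        rw [Walk.length_cons]; exact heven.add_one) (by
        rw [Walk.length_cons]; have := hlen rfl; omega))
      rw [hsupp] at hpack
      rw [← Finset.union_sdiff_of_subset hpC, hD]
      refine hpack.union hm.isPackable ?_
      rw [← hD]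
      exact Finset.disjoint_sdiff
    · obtain ⟨hy1, hy2, hy3⟩ := hm' x (by simp [hx])
      obtain ⟨y, hy⟩ : ∃ y, y = m' x := ⟨_, rfl⟩
      rw [← hy] at hy1 hy2 hy3
      have hyD : y ∈ D := by
        simp only [Finset.mem_erase, Finset.mem_insert] at hy1
        exact hy1.2.resolve_left hy2.ne'
      obtain ⟨hz1, hz2, hz3⟩ := hm y hyD
      obtain ⟨z, hz⟩ : ∃ z, z = m y := ⟨_, rfl⟩
      rw [← hz] at hz1 hz2 hz3
      have hyw : y ≠ w := (Finset.mem_erase.1 hy1).1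
      have hmemD : ∀ t, t ∈ D → t ∈ C ∧ t ∉ p.support := by
        intro t ht
        rw [← hD] at ht
        simpa using ht
      have hsupp : ((p.concat hy2).concat hz2).support.toFinset
          = p.support.toFinset ∪ {y, z} := by
        ext t
        simp [Walk.support_concat]
      have hD' : C \ ((p.concat hy2).concat hz2).support.toFinset = D \ {y, z} := by
        rw [hsupp, ← hD, Finset.sdiff_union_distrib]
        ext t
        simp only [Finset.mem_inter, Finset.mem_sdiff]
        tauto
      have hset : (insert z (D \ {y, z})).erase w
          = ((insert x D).erase w) \ {x, m' x} := by
        rw [← hy]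
        ext t
        simp only [Finset.mem_erase, Finset.mem_insert, Finset.mem_sdiff, Finset.mem_singleton]
        constructor
        · rintro ⟨h1, rfl | h2⟩
          · exact ⟨⟨h1, .inr hz1⟩, not_or.2 ⟨fun h => hxD (h ▸ hz1), hz2.ne'⟩⟩
          · exact ⟨⟨h1, .inr h2.1⟩, not_or.2 ⟨fun h => hxD (h ▸ h2.1), fun h => h2.2 (.inl h)⟩⟩
        · rintro ⟨⟨h1, h2⟩, h3⟩
          refine ⟨h1, ?_⟩
          by_cases htz : t = z
          · exact .inl htz
          · tauto
      refine ih (D \ {y, z}) (Finset.sdiff_ssubset ?_ ⟨y, by simp⟩)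
        ((p.concat hy2).concat hz2) ?_ ?_ ?_ ?_ hD' ?_ ?_ ?_
      · intro t ht
        simp only [Finset.mem_insert, Finset.mem_singleton] at ht
        rcases ht with rfl | rfl <;> assumption
      · refine (hp.concat (hmemD y hyD).2 hy2).concat ?_ hz2
        rw [Walk.support_concat]
        simp only [List.mem_append, List.mem_singleton, not_or]
        exact ⟨(hmemD z hz1).2, hz2.ne'⟩
      · rw [Walk.length_concat, Walk.length_concat, add_assoc]
        exact heven.add even_two
      · rw [hsupp]
        refine Finset.union_subset hpC ?_
        intro t ht
        simp only [Finset.mem_insert, Finset.mem_singleton] at ht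
        rcases ht with rfl | rfl
        · exact (hmemD _ hyD).1
        · exact (hmemD _ hz1).1
      -- Arriving at `w` after only two edges would close a triangle; this is what `hne` excludes.
      · intro hzw
        rw [Walk.length_concat, Walk.length_concat]
        obtain ⟨k, hk⟩ := heven
        rcases Nat.eq_zero_or_pos p.length with h0 | h0
        · have := Walk.eq_of_length_eq_zero h0
          subst this
          exact (hne (by rw [← hy, ← hz, hzw])).elim
        · omega
      · subst hz
        exact hm.sdiff_pair hyD
      · rw [hset]
        exact hm'.sdiff_pair (by simp [hx])
      · intro hzw
        simp only [Finset.mem_sdiff, Finset.mem_insert, Finset.mem_singleton, not_or]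
        exact ⟨hw hx, hyw.symm, hzw.symm⟩

/-- Alternating between `m'` and `m` from `v` leads to `w` along an even path, which `v w` closes to
an odd cycle; the other nodes remain matched by `m`. So `C` is packable unless that cycle is a
triangle, whose third node is then the partner of both `w` and `v`. -/
theorem Matches.apply_eq_apply_of_not_isPackable {C : Finset V} {v w : V} {m m' : V → V}
    (hC : ¬ G.IsPackable C) (hv : v ∈ C) (hw : w ∈ C) (hadj : G.Adj v w)
    (hm : G.Matches m (C.erase v)) (hm' : G.Matches m' (C.erase w)) : m w = m' v := by
  by_contra hne
  have hv' := hm' v (by simp [hv, hadj.ne])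
  have hD : C \ (Walk.nil : G.Walk v v).support.toFinset = C.erase v := by
    simp [Finset.sdiff_singleton_eq_erase]
  refine hC (isPackable_of_alternating (m := m) (m' := m') hadj ?_ Walk.nil Walk.IsPath.nil
    (by simp) (by simpa using hv) ?_ ?_ ?_ ?_)
  · intro h
    have h1 := (hm (m' v) (by
      rw [Finset.mem_erase]; exact ⟨hv'.2.1.ne', Finset.mem_of_mem_erase hv'.1⟩)).2.2
    rw [h] at h1
    exact hne h1
  · rwa [hD]
  · rwa [hD, Finset.insert_erase hv]
  · intro _
    rw [hD]
    simp [hw, hadj.ne']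
  · intro h
    exact (hadj.ne h).elim

theorem IsTightTriangle.rotate {C : Finset V} {a b c : V} (ha : a ∈ C)
    (h : G.IsTightTriangle C a b c) : G.IsTightTriangle C b c a :=
  ⟨ha, h.matched_mid, h.matched_right, h.matched_left, h.adj_mid, h.adj_right, h.adj_left⟩

/-- The third node is the common partner of `b` and `a` in matchings missing `a` and `b`
respectively. Comparing an arbitrary matching with a fixed one across an edge of the triangle shows
that the choice of matchings is immaterial. -/
theorem exists_isTightTriangle {C : Finset V} (hC : ¬ G.IsPackable C)
    (hfc : ∀ v ∈ C, ∃ m, G.Matches m (C.erase v)) {a b : V} (ha : a ∈ C) (hb : b ∈ C)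
    (hadj : G.Adj a b) : ∃ c, G.IsTightTriangle C a b c := by
  obtain ⟨ma, hma⟩ := hfc a ha
  obtain ⟨mb, hmb⟩ := hfc b hb
  have hkey := Matches.apply_eq_apply_of_not_isPackable hC ha hb hadj hma hmb
  obtain ⟨h1, h2, h3⟩ := hma b (by simp [hb, hadj.ne'])
  obtain ⟨h4, h5, h6⟩ := hmb a (by simp [ha, hadj.ne])
  have hc := Finset.mem_of_mem_erase h1
  rw [← hkey] at h4 h5 h6
  refine ⟨ma b, hc, ?_, ?_, ?_, hadj, h2, h5.symm⟩
  · intro m hm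
    rw [hkey, Matches.apply_eq_apply_of_not_isPackable hC ha hb hadj hm hmb]
  · intro m hm
    rw [Matches.apply_eq_apply_of_not_isPackable hC ha hb hadj hma hm]
    exact (hm a (by simp [ha, hadj.ne])).2.2
  · intro m hm
    rw [← Matches.apply_eq_apply_of_not_isPackable hC ha hc h5 hma hm, h3]

theorem Hits.rotate {m : V → V} {r a b c : V} (h : Hits m r a b c) : Hits m r b c a := by
  unfold Hits at *
  tauto

/-- The missed node of a near-perfect matching can be moved to a neighbour without changing the
set of tight triangles used. -/
theorem Matches.exists_move {C : Finset V} {r r' z : V} {m : V → V} (hr : r ∈ C) (hr' : r' ∈ C)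
    (hm : G.Matches m (C.erase r)) (hz : G.IsTightTriangle C r r' z) :
    ∃ m', G.Matches m' (C.erase r') ∧
      ∀ a ∈ C, ∀ b ∈ C, ∀ c, G.IsTightTriangle C a b c → Hits m' r' a b c → Hits m r a b c := by
  have hrz : m r' = z := hz.matched_left m hm
  have hzr : m z = r' := by
    rw [← hrz]; exact (hm r' (by simp [hr', hz.adj_left.ne'])).2.2
  have n1 := hz.adj_left.ne
  have n2 := hz.adj_mid.ne
  have n3 := hz.adj_right.ne
  -- Exchange the matching edge `r' z` for `r z`.
  let m' : V → V := fun x => if x = r then z else if x = z then r else m x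
  have e1 : m' r = z := by simp [m']
  have e2 : m' z = r := by simp [m', n3]
  have e3 : ∀ x, x ≠ r → x ≠ z → m' x = m x := fun x h1 h2 => by simp [m', h1, h2]
  refine ⟨m', ?_, ?_⟩
  · intro x hx
    rw [Finset.mem_erase] at hx
    by_cases hxr : x = r
    · subst hxr
      rw [e1, e2]
      exact ⟨Finset.mem_erase.2 ⟨n2.symm, hz.mem⟩, hz.adj_right.symm, rfl⟩
    by_cases hxz : x = z
    · subst hxz
      rw [e2, e1]
      exact ⟨Finset.mem_erase.2 ⟨n1, hr⟩, hz.adj_right, rfl⟩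
    obtain ⟨h1, h2, h3⟩ := hm x (by simp [hxr, hx])
    rw [Finset.mem_erase] at h1
    have hmz : m x ≠ z := by
      intro h
      rw [h, hzr] at h3
      exact hx.1 h3.symm
    have hmr' : m x ≠ r' := by
      intro h
      rw [h, hrz] at h3
      exact hxz h3.symm
    rw [e3 x hxr hxz, e3 _ h1.1 hmz]
    exact ⟨Finset.mem_erase.2 ⟨hmr', h1.2⟩, h2, h3⟩
  -- The only new edge is `r z`. A tight triangle containing it contains `r`, which `m` misses, so
  -- by tightness `m` already joins its other two nodes.
  · have core : ∀ a b c, G.IsTightTriangle C a b c → m' a = b → Hits m r a b c := by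
      intro a b c ht hab
      by_cases har : a = r
      · subst har
        obtain rfl : b = z := by rw [← hab, e1]
        exact .inr (.inl ⟨n3, ht.matched_left m hm⟩)
      by_cases haz : a = z
      · subst haz
        obtain rfl : b = r := by rw [← hab, e2]
        exact .inr (.inr ⟨ht.adj_mid.ne', ht.matched_mid m hm⟩)
      · exact .inl ⟨har, by rw [← hab, e3 a har haz]⟩
    rintro a ha b hb c ht (⟨-, h⟩ | ⟨-, h⟩ | ⟨-, h⟩)
    · exact core a b c ht h
    · exact (core b c a (ht.rotate ha) h).rotate.rotate
    · exact (core c a b ((ht.rotate ha).rotate hb) h).rotate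

/-- Moving the missed node along edges never enlarges the set of tight triangles used, and
factor-criticality lets it travel to `a`. A matching missing `a` uses the triangle by tightness,
hence so does `m`. -/
theorem hits_of_isTightTriangle {C : Finset V} (hC : ¬ G.IsPackable C)
    (hfc : ∀ v ∈ C, ∃ m, G.Matches m (C.erase v)) {r : V} {m : V → V} (hr : r ∈ C)
    (hm : G.Matches m (C.erase r)) {a b c : V} (ha : a ∈ C) (hb : b ∈ C)
    (ht : G.IsTightTriangle C a b c) : Hits m r a b c := by
  classical
  let Z := C.filter fun v => ∃ m', G.Matches m' (C.erase v) ∧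
    ∀ a ∈ C, ∀ b ∈ C, ∀ c, G.IsTightTriangle C a b c → Hits m' v a b c → Hits m r a b c
  have hrZ : r ∈ Z := Finset.mem_filter.2 ⟨hr, m, hm, fun _ _ _ _ _ _ h => h⟩
  have hclosed : ∀ v ∈ Z, ∀ w ∈ C, G.Adj v w → w ∈ Z := by
    intro v hv w hw hadj
    obtain ⟨hvC, m₁, hm₁, h₁⟩ := Finset.mem_filter.1 hv
    obtain ⟨z, hz⟩ := exists_isTightTriangle hC hfc hvC hw hadj
    obtain ⟨m₂, hm₂, h₂⟩ := hm₁.exists_move hvC hw hz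
    exact Finset.mem_filter.2 ⟨hw, m₂, hm₂, fun a ha b hb c hc h =>
      h₁ a ha b hb c hc (h₂ a ha b hb c hc h)⟩
  -- `Z` is closed under adjacency in `C`. Were `a` outside, a matching missing `a` would restrict
  -- to `Z` and `m` to `Z` without `r`, making both cardinalities even.
  have hall : a ∈ Z := by
    by_contra haZ
    obtain ⟨ma, hma⟩ := hfc a ha
    have h1 : G.Matches ma Z := by
      intro v hv
      have hva : v ≠ a := by rintro rfl; exact haZ hv
      obtain ⟨h1, h2, h3⟩ := hma v (by simp [hva, (Finset.mem_filter.1 hv).1])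
      exact ⟨hclosed v hv _ (Finset.mem_of_mem_erase h1) h2, h2, h3⟩
    have h2 : G.Matches m (Z.erase r) := by
      intro v hv
      rw [Finset.mem_erase] at hv
      obtain ⟨h1, h2, h3⟩ := hm v (by simp [hv.1, (Finset.mem_filter.1 hv.2).1])
      rw [Finset.mem_erase] at h1
      exact ⟨Finset.mem_erase.2 ⟨h1.1, hclosed v hv.2 _ h1.2 h2⟩, h2, h3⟩
    have h3 := h1.even_card
    have h4 := h2.even_card
    rw [← Finset.card_erase_add_one hrZ] at h3
    exact (Nat.even_add_one.1 h3) h4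
  obtain ⟨-, m', hm', h'⟩ := Finset.mem_filter.1 hall
  exact h' a ha b hb c ht (.inr (.inl ⟨ht.adj_left.ne', ht.matched_left m' hm'⟩))

/-- A factor-critical set that is not packable induces at most `3 (|C| - 1) / 2` edges. -/
theorem sum_card_filter_adj_le [DecidableRel G.Adj] {C : Finset V} (hC : ¬ G.IsPackable C)
    (hfc : ∀ v ∈ C, ∃ m, G.Matches m (C.erase v)) :
    ∑ v ∈ C, (C.filter fun w => G.Adj v w).card ≤ 3 * (C.card - 1) := by
  rcases C.eq_empty_or_nonempty with rfl | ⟨r, hr⟩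
  · simp
  obtain ⟨m, hm⟩ := hfc r hr
  have hex : ∀ x, ∃ t, x ∈ C.erase r → G.IsTightTriangle C x (m x) t := by
    intro x
    by_cases hx : x ∈ C.erase r
    · obtain ⟨h1, h2, -⟩ := hm x hx
      obtain ⟨t, ht⟩ := exists_isTightTriangle hC hfc (Finset.mem_of_mem_erase hx)
        (Finset.mem_of_mem_erase h1) h2
      exact ⟨t, fun _ => ht⟩
    · exact ⟨x, fun h => (hx h).elim⟩
  choose t ht using hex
  have huniq : ∀ a ∈ C, ∀ b c c', G.IsTightTriangle C a b c → G.IsTightTriangle C a b c' →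
      c = c' := by
    intro a ha b c c' h h'
    obtain ⟨ma, hma⟩ := hfc a ha
    rw [← h.matched_left ma hma, h'.matched_left ma hma]
  rw [← Finset.card_sigma, mul_comm, ← Finset.card_erase_of_mem hr]
  -- Ordered adjacent pairs are counted. Each lies on a tight triangle that `m` uses; starting at a
  -- suitable end `x` of the matching edge fixes an orientation, so each `x` accounts for three
  -- pairs.
  refine le_trans (Finset.card_le_card (t := (C.erase r).biUnion fun x =>
    {⟨x, m x⟩, ⟨m x, t x⟩, ⟨t x, x⟩}) ?_)
    (Finset.card_biUnion_le_card_mul _ _ _ fun x _ => Finset.card_le_three)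
  rintro ⟨a, b⟩ hab
  simp only [Finset.mem_sigma, Finset.mem_filter] at hab
  obtain ⟨ha, hb, hadj⟩ := hab
  obtain ⟨c, hc⟩ := exists_isTightTriangle hC hfc ha hb hadj
  rw [Finset.mem_biUnion]
  rcases hits_of_isTightTriangle hC hfc hr hm ha hb hc with ⟨h1, h2⟩ | ⟨h1, h2⟩ | ⟨h1, h2⟩
  · exact ⟨a, by simp [h1, ha], by simp [h2]⟩
  · have hb' : b ∈ C.erase r := by simp [h1, hb]
    have h3 := ht b hb'
    rw [h2] at h3
    obtain rfl := huniq b hb c _ _ h3 (hc.rotate ha)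
    exact ⟨b, hb', by simp⟩
  · have hc' : c ∈ C.erase r := by simp [h1, hc.mem]
    have h3 := ht c hc'
    rw [h2] at h3
    obtain rfl := huniq c hc.mem a _ _ h3 ((hc.rotate ha).rotate hb)
    exact ⟨c, hc', by simp [h2]⟩

end

end SimpleGraph

/-! ### Barriers of Gallai–Edmonds type -/

namespace SimpleGraph

/-- `P` is a family of disjoint odd node sets, each of which is a union of components of `G - S`. -/
structure IsBarrier {V : Type*} (G : SimpleGraph V) (S : Finset V) (P : Finset (Finset V)) :
    Prop where
  odd : ∀ K ∈ P, Odd K.card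
  disjoint : ∀ K ∈ P, Disjoint K S
  pairwise : ∀ K ∈ P, ∀ L ∈ P, K ≠ L → Disjoint K L
  closed : ∀ K ∈ P, ∀ v ∈ K, ∀ w, G.Adj v w → w ∈ K ∨ w ∈ S

section

variable {V : Type*} [Fintype V] [DecidableEq V] {G : SimpleGraph V}

/-- Tutte's theorem for the subgraph induced by a finite set of nodes. -/
theorem exists_matches_or_violator (G : SimpleGraph V) (W : Finset V) :
    (∃ m, G.Matches m W) ∨ ∃ U ⊆ W, ∃ Q : Finset (Finset V), U.card < Q.card ∧
      (Odd (Q.card + U.card) ↔ Odd W.card) ∧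
      (∀ K ∈ Q, K ⊆ W \ U ∧ Odd K.card ∧ ∀ v ∈ K, ∀ w ∈ W \ U, G.Adj v w → w ∈ K) ∧
      ∀ K ∈ Q, ∀ L ∈ Q, K ≠ L → Disjoint K L := by
  classical
  by_cases hM : ∃ M : Subgraph (G.induce (W : Set V)), M.IsPerfectMatching
  · left
    obtain ⟨M, hM⟩ := hM
    rw [Subgraph.isPerfectMatching_iff] at hM
    choose p hp hp' using hM
    refine ⟨fun v => if h : v ∈ W then (p ⟨v, h⟩ : V) else v, ?_⟩
    intro v hv
    have h1 : ((p ⟨v, hv⟩ : (W : Set V)) : V) ∈ W := (p ⟨v, hv⟩).2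
    have h2 : p (p ⟨v, hv⟩) = ⟨v, hv⟩ := (hp' _ _ (hp ⟨v, hv⟩).symm).symm
    simp only [hv, h1, dif_pos]
    refine ⟨trivial, (hp ⟨v, hv⟩).adj_sub, ?_⟩
    have : (⟨(p ⟨v, hv⟩ : V), h1⟩ : (W : Set V)) = p ⟨v, hv⟩ := rfl
    rw [this, h2]
  · right
    rw [tutte] at hM
    push Not at hM
    obtain ⟨u, hu⟩ := hM
    unfold IsTutteViolator at hu
    let D := (⊤ : (G.induce (W : Set V)).Subgraph).deleteVerts u
    have hDv : ∀ x, x ∈ D.verts ↔ x ∉ u := by intro x; simp [D]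
    let φ : D.verts → V := fun x => x.1.1
    have hφ : Function.Injective φ := fun x y h => Subtype.ext (Subtype.ext h)
    let f : D.coe.ConnectedComponent → Finset V := fun c => (φ '' c.supp).toFinset
    have hf : Function.Injective f := by
      intro c c' h
      exact ConnectedComponent.supp_injective (hφ.image_injective (Set.toFinset_inj.1 h))
    have hfcard : ∀ c, (f c).card = c.supp.ncard := by
      intro c
      rw [← Set.ncard_image_of_injective _ hφ, Set.ncard_eq_toFinset_card']
    have hmemf : ∀ c v, v ∈ f c ↔ ∃ x : D.verts, D.coe.connectedComponentMk x = c ∧ x.1.1 = v := by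
      intro c v
      simp [f, φ]
    let U : Finset V := (Subtype.val '' u).toFinset
    have hU : U.card = u.ncard := by
      rw [← Set.ncard_image_of_injective _ Subtype.val_injective, Set.ncard_eq_toFinset_card']
    have hmemU : ∀ x : (W : Set V), x.1 ∈ U ↔ x ∈ u := by
      intro x
      simp [U]
    let Q : Finset (Finset V) := (f '' D.coe.oddComponents).toFinset
    have hQ : Q.card = D.coe.oddComponents.ncard := by
      rw [← Set.ncard_image_of_injective _ hf, Set.ncard_eq_toFinset_card']
    have hUW : U ⊆ W := by
      intro v hv
      simp only [U, Set.mem_toFinset] at hv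
      obtain ⟨x, -, rfl⟩ := hv
      exact x.2
    refine ⟨U, hUW, Q, ?_, ?_, ?_, ?_⟩
    · rw [hU, hQ]
      exact hu
    -- The number of odd components has the parity of the number of remaining nodes.
    · have h1 := odd_ncard_oddComponents D.coe
      rw [← hQ] at h1
      have h2 : Nat.card D.verts + U.card = W.card := by
        have : D.verts = uᶜ := by ext x; simp [hDv]
        rw [Nat.card_coe_set_eq, this, hU, add_comm, Set.ncard_add_ncard_compl]
        simp
      rw [← h2, Nat.odd_add, Nat.odd_add, h1]
    · intro K hK
      simp only [Q, Set.mem_toFinset] at hK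
      obtain ⟨c, hc, rfl⟩ := hK
      refine ⟨?_, ?_, ?_⟩
      · intro v hv
        obtain ⟨x, -, rfl⟩ := (hmemf c v).1 hv
        rw [Finset.mem_sdiff, hmemU, ← hDv]
        exact ⟨x.1.2, x.2⟩
      · rw [hfcard]
        exact hc
      · intro v hv w hw hadj
        obtain ⟨x, hx, rfl⟩ := (hmemf c v).1 hv
        rw [Finset.mem_sdiff] at hw
        have hwD : (⟨w, hw.1⟩ : (W : Set V)) ∈ D.verts := by
          rw [hDv, ← hmemU]
          exact hw.2
        refine (hmemf c w).2 ⟨⟨⟨w, hw.1⟩, hwD⟩, ?_, rfl⟩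
        rw [← hx]
        refine (ConnectedComponent.connectedComponentMk_eq_of_adj ?_).symm
        have h1 := (hDv _).1 x.2
        have h2 := (hDv _).1 hwD
        simp [D, h1, h2, hadj]
    · intro K hK L hL hne
      simp only [Q, Set.mem_toFinset] at hK hL
      obtain ⟨c, -, rfl⟩ := hK
      obtain ⟨c', -, rfl⟩ := hL
      rw [Finset.disjoint_left]
      intro v hv hv'
      obtain ⟨x, hx, hxv⟩ := (hmemf c v).1 hv
      obtain ⟨y, hy, hyv⟩ := (hmemf c' v).1 hv'
      have : x = y := hφ (hxv.trans hyv.symm)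
      subst this
      exact hne (by rw [← hx, ← hy])

omit [Fintype V] in
-- This refines a barrier inside a region `W` that is separated by `S` from the rest and meets no
-- piece; the surplus of pieces over barrier nodes changes by `|Q| - |U|`.
theorem IsBarrier.union {S : Finset V} {P : Finset (Finset V)} (h : G.IsBarrier S P)
    {W U : Finset V} {Q : Finset (Finset V)} (hWS : Disjoint W S)
    (hWP : ∀ K ∈ P, Disjoint K W)
    (hW : ∀ v ∈ W, ∀ w, G.Adj v w → w ∈ W ∨ w ∈ S) (hU : U ⊆ W)
    (hQ : ∀ K ∈ Q, K ⊆ W \ U ∧ Odd K.card ∧ ∀ v ∈ K, ∀ w ∈ W \ U, G.Adj v w → w ∈ K)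
    (hQ' : ∀ K ∈ Q, ∀ L ∈ Q, K ≠ L → Disjoint K L) :
    G.IsBarrier (S ∪ U) (P ∪ Q) ∧ (S ∪ U).card = S.card + U.card ∧
      (P ∪ Q).card = P.card + Q.card := by
  have hQW : ∀ K ∈ Q, K ⊆ W := fun K hK => (hQ K hK).1.trans Finset.sdiff_subset
  refine ⟨⟨?_, ?_, ?_, ?_⟩, ?_, ?_⟩
  · intro K hK
    rcases Finset.mem_union.1 hK with hK | hK
    · exact h.odd K hK
    · exact (hQ K hK).2.1
  · intro K hK
    rw [Finset.disjoint_union_right]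
    rcases Finset.mem_union.1 hK with hK | hK
    · exact ⟨h.disjoint K hK, (hWP K hK).mono_right hU⟩
    · exact ⟨hWS.mono_left (hQW K hK), Finset.disjoint_sdiff.symm.mono_left (hQ K hK).1⟩
  · intro K hK L hL hne
    rcases Finset.mem_union.1 hK with hK | hK <;> rcases Finset.mem_union.1 hL with hL | hL
    · exact h.pairwise K hK L hL hne
    · exact (hWP K hK).mono_right (hQW L hL)
    · exact ((hWP L hL).mono_right (hQW K hK)).symm
    · exact hQ' K hK L hL hne
  · intro K hK v hv w hadj
    rw [Finset.mem_union]
    rcases Finset.mem_union.1 hK with hK | hK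
    · rcases h.closed K hK v hv w hadj with h1 | h1
      · exact .inl h1
      · exact .inr (.inl h1)
    · rcases hW v (hQW K hK hv) w hadj with h1 | h1
      · by_cases hwU : w ∈ U
        · exact .inr (.inr hwU)
        · exact .inl ((hQ K hK).2.2 v hv w (Finset.mem_sdiff.2 ⟨h1, hwU⟩) hadj)
      · exact .inr (.inl h1)
  · exact Finset.card_union_of_disjoint (hWS.symm.mono_right hU)
  · refine Finset.card_union_of_disjoint (Finset.disjoint_left.2 fun K hK hK' => ?_)
    have h1 : Disjoint K K := (hWP K hK).mono_right (hQW K hK')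
    have h2 := h.odd K hK
    rw [Finset.disjoint_self_iff_empty] at h1
    simp [h1] at h2

/-- A barrier whose pieces are factor-critical, whose remaining nodes are perfectly matched, and
whose node set can be matched into the pieces. -/
theorem exists_isBarrier (G : SimpleGraph V) : ∃ S P, G.IsBarrier S P ∧
    (∀ K ∈ P, ∀ c ∈ K, ∃ m, G.Matches m (K.erase c)) ∧
    (∃ m, G.Matches m (Finset.univ \ (S ∪ P.biUnion id))) ∧
    ∃ f : S → Finset V, Function.Injective f ∧
      ∀ s, f s ∈ P ∧ ∃ v ∈ f s, G.Adj s.1 v := by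
  classical
  -- As `|S| ≤ |V|`, the factor `|V| + 1` makes this a lexicographic maximum: first of `|P| - |S|`,
  -- then of `|S|`.
  obtain ⟨⟨S, P⟩, hSP, hmax⟩ := Finset.exists_max_image
    (Finset.univ.filter fun x : Finset V × Finset (Finset V) => G.IsBarrier x.1 x.2)
    (fun x => ((x.2.card : ℤ) - x.1.card) * (Fintype.card V + 1) + x.1.card)
    ⟨(∅, ∅), Finset.mem_filter.2 ⟨Finset.mem_univ _, ⟨by simp, by simp, by simp, by simp⟩⟩⟩
  replace hSP : G.IsBarrier S P := (Finset.mem_filter.1 hSP).2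
  replace hmax : ∀ S' P', G.IsBarrier S' P' → ((P'.card : ℤ) - S'.card) * (Fintype.card V + 1)
      + S'.card ≤ ((P.card : ℤ) - S.card) * (Fintype.card V + 1) + S.card :=
    fun S' P' h => hmax (S', P') (Finset.mem_filter.2 ⟨Finset.mem_univ _, h⟩)
  have hbig : ∀ S' P', G.IsBarrier S' P' → ¬ P.card + S'.card < P'.card + S.card := by
    intro S' P' h hlt
    have h1 := hmax S' P' h
    have h2 : (S.card : ℤ) ≤ Fintype.card V := by exact_mod_cast Finset.card_le_univ S
    have h3 : (P.card : ℤ) - S.card + 1 ≤ P'.card - S'.card := by omega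
    nlinarith
  have hbig' : ∀ S' P', G.IsBarrier S' P' → P.card + S'.card = P'.card + S.card →
      ¬ S.card < S'.card := by
    intro S' P' h heq hlt
    have h1 := hmax S' P' h
    have h3 : (P.card : ℤ) - S.card = P'.card - S'.card := by omega
    rw [h3] at h1
    omega
  refine ⟨S, P, hSP, ?_, ?_, ?_⟩
  -- Factor-criticality: given a violator `U` of `K - c`, move `c` and `U` into the barrier and
  -- replace `K` by the pieces in `Q`.
  · intro K hK c hc
    refine (exists_matches_or_violator G (K.erase c)).resolve_right ?_
    rintro ⟨U, hU, Q, hUQ, hpar, hQ, hQ'⟩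
    have hodd := hSP.odd K hK
    have hcS : c ∉ S := Finset.disjoint_left.1 (hSP.disjoint K hK) hc
    have hSP' : G.IsBarrier (insert c S) (P.erase K) := by
      refine ⟨fun L hL => hSP.odd L (Finset.mem_of_mem_erase hL), ?_,
        fun L hL L' hL' => hSP.pairwise L (Finset.mem_of_mem_erase hL) L'
          (Finset.mem_of_mem_erase hL'), ?_⟩
      · intro L hL
        rw [Finset.mem_erase] at hL
        rw [Finset.disjoint_insert_right]
        exact ⟨fun h => Finset.disjoint_left.1 (hSP.pairwise L hL.2 K hK hL.1) h hc,
          hSP.disjoint L hL.2⟩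
      · intro L hL v hv w hadj
        rcases hSP.closed L (Finset.mem_of_mem_erase hL) v hv w hadj with h | h
        · exact .inl h
        · exact .inr (Finset.mem_insert_of_mem h)
    obtain ⟨h1, h2, h3⟩ := hSP'.union (W := K.erase c) (by
        rw [Finset.disjoint_insert_right]
        exact ⟨by simp, (hSP.disjoint K hK).mono_left (Finset.erase_subset _ _)⟩) (by
        intro L hL
        rw [Finset.mem_erase] at hL
        exact (hSP.pairwise L hL.2 K hK hL.1).mono_right (Finset.erase_subset _ _)) (by
        intro v hv w hadj
        rcases hSP.closed K hK v (Finset.mem_of_mem_erase hv) w hadj with h | h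
        · by_cases hwc : w = c
          · exact .inr (by simp [hwc])
          · exact .inl (by simp [hwc, h])
        · exact .inr (Finset.mem_insert_of_mem h)) hU hQ hQ'
    rw [Finset.card_insert_of_notMem hcS] at h2
    have h4 := Finset.card_erase_add_one hK
    have h5 := Finset.card_erase_add_one hc
    -- `K - c` has even order, so parity improves the excess from one to two. This pays for losing
    -- `K` and adding `c`; with equality the surplus is unchanged but the barrier has grown.
    have h6 : U.card + 2 ≤ Q.card := by
      by_contra hlt
      have : Q.card = U.card + 1 := by omega
      rw [this] at hpar
      grind
    by_cases h7 : Q.card = U.card + 2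
    · exact hbig' _ _ h1 (by omega) (by omega)
    · exact hbig _ _ h1 (by omega)
  · refine (exists_matches_or_violator G _).resolve_right ?_
    rintro ⟨U, hU, Q, hUQ, -, hQ, hQ'⟩
    obtain ⟨h1, h2, h3⟩ := hSP.union (by
        refine Finset.sdiff_disjoint.mono_right Finset.subset_union_left) (by
        intro K hK
        refine Finset.disjoint_sdiff.mono_left (subset_trans ?_ Finset.subset_union_right)
        exact Finset.subset_biUnion_of_mem id hK) (by
        intro v hv w hadj
        simp only [Finset.mem_sdiff, Finset.mem_univ, true_and, Finset.mem_union,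
          Finset.mem_biUnion, id, not_or, not_exists, not_and] at hv ⊢
        by_cases hwS : w ∈ S
        · exact .inr hwS
        refine .inl ⟨hwS, fun K hK hwK => ?_⟩
        rcases hSP.closed K hK w hwK v hadj.symm with h | h
        · exact hv.2 K hK h
        · exact hv.1 h) hU hQ hQ'
    exact hbig _ _ h1 (by omega)
  -- Hall's condition: if `X ⊆ S` met fewer than `|X|` pieces, discarding `X` and those pieces would
  -- raise the surplus.
  · obtain ⟨f, hf, hf'⟩ := (Finset.all_card_le_biUnion_card_iff_exists_injective
      (fun s : S => P.filter fun K => ∃ v ∈ K, G.Adj s.1 v)).1 (by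
        intro X
        by_contra hlt
        push Not at hlt
        obtain ⟨N, hN⟩ : ∃ N, N = X.biUnion fun s : S => P.filter fun K => ∃ v ∈ K, G.Adj s.1 v :=
          ⟨_, rfl⟩
        rw [← hN] at hlt
        have hNP : N ⊆ P := by
          rw [hN]
          exact Finset.biUnion_subset.2 fun s _ => Finset.filter_subset _ _
        have hX : X.map (Function.Embedding.subtype _) ⊆ S := by
          intro v hv
          obtain ⟨s, -, rfl⟩ := Finset.mem_map.1 hv
          exact s.2
        refine hbig (S \ X.map (Function.Embedding.subtype _)) (P \ N) ⟨?_, ?_, ?_, ?_⟩ ?_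
        · exact fun K hK => hSP.odd K (Finset.sdiff_subset hK)
        · exact fun K hK => (hSP.disjoint K (Finset.sdiff_subset hK)).mono_right
            Finset.sdiff_subset
        · exact fun K hK L hL => hSP.pairwise K (Finset.sdiff_subset hK) L
            (Finset.sdiff_subset hL)
        · intro K hK v hv w hadj
          rw [Finset.mem_sdiff] at hK
          rcases hSP.closed K hK.1 v hv w hadj with h | h
          · exact .inl h
          · refine .inr (Finset.mem_sdiff.2 ⟨h, fun hw => hK.2 ?_⟩)
            obtain ⟨s, hs, rfl⟩ := Finset.mem_map.1 hw
            rw [hN]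
            exact Finset.mem_biUnion.2 ⟨s, hs, Finset.mem_filter.2 ⟨hK.1, v, hv, hadj.symm⟩⟩
        · have h1 := Finset.card_sdiff_add_card_eq_card hNP
          have h2 := Finset.card_sdiff_add_card_eq_card hX
          rw [Finset.card_map] at h2
          omega)
    exact ⟨f, hf, fun s => Finset.mem_filter.1 (hf' s)⟩

end

end SimpleGraph

/-! ### Matching pieces into the barrier, and the final cover -/

namespace SimpleGraph

section

/-- Elements of `B` reached by alternating between `f` and `g` from an element not in the range
of `f`. -/
inductive AlternatingReach {α β : Type*} (f : α → β) (B : Set β) (g : B → α) : B → Prop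
  | base (b : B) (hb : ∀ a, f a ≠ b) : AlternatingReach f B g b
  | step (b b' : B) (h : AlternatingReach f B g b) (hb : f (g b) = b') : AlternatingReach f B g b'

/-- **Mendelsohn–Dulmage theorem**: a matching covering `α` and a matching covering `B`
can be combined to a matching covering both. -/
theorem exists_injective_and_subset_range {α β : Type*} (r : α → β → Prop) {f : α → β}
    (hf : Function.Injective f) (hfr : ∀ a, r a (f a)) {B : Set β} {g : B → α}
    (hg : Function.Injective g) (hgr : ∀ b, r (g b) b) :
    ∃ h : α → β, Function.Injective h ∧ (∀ a, r a (h a)) ∧ B ⊆ Set.range h := by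
  classical
  -- `h` follows `g` backwards at the `g`-partners of reached elements and agrees with `f`
  -- elsewhere.
  have hex : ∀ a, ∃ c : β, (∀ b, AlternatingReach f B g b → g b = a → c = b) ∧
      ((¬ ∃ b, AlternatingReach f B g b ∧ g b = a) → c = f a) := by
    intro a
    by_cases ha : ∃ b, AlternatingReach f B g b ∧ g b = a
    · obtain ⟨b, hb, hba⟩ := ha
      exact ⟨b, fun b' _ hb' => by rw [hg (hba.trans hb'.symm)], fun h => (h ⟨b, hb, hba⟩).elim⟩
    · exact ⟨f a, fun b hb hba => (ha ⟨b, hb, hba⟩).elim, fun _ => rfl⟩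
  choose h h1 h2 using hex
  have hmix : ∀ b a, AlternatingReach f B g b → (b : β) = f a →
      ∃ b', AlternatingReach f B g b' ∧ g b' = a := by
    intro b a hb hba
    cases hb with
    | base _ hb => exact (hb a hba.symm).elim
    | step b' _ hb' h => exact ⟨b', hb', hf (h.trans hba)⟩
  refine ⟨h, ?_, ?_, ?_⟩
  · intro a a' haa
    by_cases ha : ∃ b, AlternatingReach f B g b ∧ g b = a <;>
      by_cases ha' : ∃ b, AlternatingReach f B g b ∧ g b = a'
    · obtain ⟨b, hb, rfl⟩ := ha
      obtain ⟨b', hb', rfl⟩ := ha'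
      rw [h1 _ b hb rfl, h1 _ b' hb' rfl] at haa
      rw [Subtype.ext haa]
    · obtain ⟨b, hb, rfl⟩ := ha
      rw [h1 _ b hb rfl, h2 _ ha'] at haa
      exact (ha' (hmix b a' hb haa)).elim
    · obtain ⟨b', hb', rfl⟩ := ha'
      rw [h1 _ b' hb' rfl, h2 _ ha] at haa
      exact (ha (hmix b' a hb' haa.symm)).elim
    · rw [h2 _ ha, h2 _ ha'] at haa
      exact hf haa
  · intro a
    by_cases ha : ∃ b, AlternatingReach f B g b ∧ g b = a
    · obtain ⟨b, hb, rfl⟩ := ha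
      rw [h1 _ b hb rfl]
      exact hgr b
    · rw [h2 _ ha]
      exact hfr a
  · intro b hb
    -- An unreached `b` equals some `f a`, and `a` keeps its `f`-value, since otherwise one more
    -- step would reach `b`.
    by_cases hr : AlternatingReach f B g ⟨b, hb⟩
    · exact ⟨_, h1 _ _ hr rfl⟩
    · have : ∃ a, f a = b := by
        by_contra hn
        push Not at hn
        exact hr (.base _ hn)
      obtain ⟨a, rfl⟩ := this
      refine ⟨a, h2 _ ?_⟩
      rintro ⟨b', hb', rfl⟩
      exact hr (.step b' _ hb' rfl)

variable {V : Type*} [Fintype V] [DecidableEq V] {G : SimpleGraph V} [DecidableRel G.Adj]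

/-- Counting edges between unpackable pieces of a barrier and their neighbours. -/
theorem IsBarrier.mul_card_le {S : Finset V} {P X : Finset (Finset V)} (h : G.IsBarrier S P)
    (hfc : ∀ K ∈ P, ∀ c ∈ K, ∃ m, G.Matches m (K.erase c)) {d : ℕ} (hd : 3 ≤ d)
    (hdeg : ∀ v, G.degree v = d ∨ G.degree v = d - 1) (hXP : X ⊆ P)
    (hX : ∀ K ∈ X, ¬ G.IsPackable K) :
    d * X.card ≤ d * (S.filter fun s => ∃ K ∈ X, ∃ v ∈ K, G.Adj s v).card
      + (Finset.univ.filter fun v => G.degree v = d - 1).card := by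
  obtain ⟨N, hN⟩ : ∃ N, N = S.filter fun s => ∃ K ∈ X, ∃ v ∈ K, G.Adj s v := ⟨_, rfl⟩
  rw [← hN]
  have hdisj : (X : Set (Finset V)).PairwiseDisjoint id := fun K hK L hL hne =>
    h.pairwise K (hXP hK) L (hXP hL) hne
  -- The degrees in `K`, corrected by one at nodes of degree `d - 1`, sum to at least `d |K|`; edges
  -- inside `K` take up at most `3 (|K| - 1) ≤ d (|K| - 1)`.
  have hpiece : ∀ K ∈ X, d ≤ ∑ v ∈ K, ((N.filter fun w => G.Adj v w).card
      + if G.degree v = d - 1 then 1 else 0) := by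
    intro K hK
    have h1 : ∀ v ∈ K, d ≤ ((N.filter fun w => G.Adj v w).card
        + if G.degree v = d - 1 then 1 else 0) + (K.filter fun w => G.Adj v w).card := by
      intro v hv
      have : G.degree v ≤ (N.filter fun w => G.Adj v w).card
          + (K.filter fun w => G.Adj v w).card := by
        rw [← card_neighborFinset_eq_degree]
        refine le_trans (Finset.card_le_card fun w hw => ?_) (Finset.card_union_le _ _)
        rw [mem_neighborFinset] at hw
        rw [Finset.mem_union, Finset.mem_filter, Finset.mem_filter]
        rcases h.closed K (hXP hK) v hv w hw with hwK | hwS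
        · exact .inr ⟨hwK, hw⟩
        · refine .inl ⟨?_, hw⟩
          rw [hN, Finset.mem_filter]
          exact ⟨hwS, K, hK, v, hv, hw.symm⟩
      rcases hdeg v with h | h
      · split_ifs <;> omega
      · rw [if_pos h]
        omega
    have h2 := Finset.card_nsmul_le_sum K _ d h1
    rw [Finset.sum_add_distrib, smul_eq_mul] at h2
    have h3 := sum_card_filter_adj_le (hX K hK) (hfc K (hXP hK))
    have h4 := (h.odd K (hXP hK)).pos
    obtain ⟨k, hk⟩ : ∃ k, K.card = k + 1 := ⟨K.card - 1, by omega⟩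
    rw [hk] at h2 h3
    have h5 : 3 * k ≤ d * k := Nat.mul_le_mul_right k hd
    rw [Nat.add_sub_cancel] at h3
    rw [add_mul, one_mul, mul_comm] at h2
    omega
  have hsum := Finset.card_nsmul_le_sum X _ d hpiece
  have hsum_eq := (Finset.sum_biUnion (t := id) (f := fun v => (N.filter fun w => G.Adj v w).card
      + if G.degree v = d - 1 then 1 else 0) hdisj).symm
  simp only [id] at hsum_eq
  change _ = ∑ v ∈ X.biUnion id, _ at hsum_eq
  rw [smul_eq_mul, mul_comm, hsum_eq, Finset.sum_add_distrib] at hsum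
  refine hsum.trans (add_le_add ?_ ?_)
  -- The same edges counted from `N`, where each node has degree at most `d`.
  · have := Finset.sum_card_bipartiteAbove_eq_sum_card_bipartiteBelow (s := X.biUnion id)
      (t := N) G.Adj
    unfold Finset.bipartiteAbove at this
    rw [this, mul_comm]
    refine Finset.sum_le_card_nsmul _ _ _ fun s _ => ?_
    refine le_trans (Finset.card_le_card (t := G.neighborFinset s) fun v hv => ?_) ?_
    · rw [mem_neighborFinset]
      exact ((Finset.mem_bipartiteBelow _).1 hv).2.symm
    · rw [card_neighborFinset_eq_degree]
      rcases hdeg s with h | h <;> omega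
  · rw [← Finset.card_filter]
    exact Finset.card_le_card (Finset.filter_subset_filter _ (Finset.subset_univ _))

/-- All but `q / d` of the unpackable pieces can be matched into the barrier. -/
theorem IsBarrier.exists_matching_of_unpackable {S : Finset V} {P : Finset (Finset V)}
    (h : G.IsBarrier S P)
    (hfc : ∀ K ∈ P, ∀ c ∈ K, ∃ m, G.Matches m (K.erase c)) {d : ℕ} (hd : 3 ≤ d)
    (hdeg : ∀ v, G.degree v = d ∨ G.degree v = d - 1) :
    ∃ (B : Set (Finset V)) (g : B → S), Function.Injective g ∧
      (∀ K : B, K.1 ∈ P ∧ ∃ v ∈ K.1, G.Adj (g K) v) ∧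
      ∀ T ⊆ P, (∀ K ∈ T, ¬ G.IsPackable K ∧ K ∉ B) →
        T.card ≤ (Finset.univ.filter fun v => G.degree v = d - 1).card / d := by
  classical
  obtain ⟨q, hq⟩ : ∃ q, q = (Finset.univ.filter fun v => G.degree v = d - 1).card := ⟨_, rfl⟩
  rw [← hq]
  let P₀ := P.filter fun K => ¬ G.IsPackable K
  -- Deficiency form of Hall's theorem: every piece may also use one of `q / d` dummy partners. `B`
  -- below consists of the pieces given a genuine partner.
  obtain ⟨g, hg, hg'⟩ := (Finset.all_card_le_biUnion_card_iff_exists_injective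
    (fun K : P₀ => (S.filter fun s => ∃ v ∈ K.1, G.Adj s v).disjSum
      (Finset.univ : Finset (Fin (q / d))))).1 (by
    intro X
    rcases X.eq_empty_or_nonempty with rfl | ⟨K₀, hK₀⟩
    · simp
    have hX : ∀ K ∈ X.map (Function.Embedding.subtype _), K ∈ P₀ := by
      intro K hK
      obtain ⟨K, -, rfl⟩ := Finset.mem_map.1 hK
      exact K.2
    have h1 := h.mul_card_le hfc hd hdeg (X := X.map (Function.Embedding.subtype _))
      (fun K hK => (Finset.mem_filter.1 (hX K hK)).1)
      (fun K hK => (Finset.mem_filter.1 (hX K hK)).2)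
    rw [← hq, Finset.card_map] at h1
    refine le_trans ?_ (Finset.card_le_card (s := (S.filter fun s =>
      ∃ K ∈ X.map (Function.Embedding.subtype _), ∃ v ∈ K, G.Adj s v).disjSum
      (Finset.univ : Finset (Fin (q / d)))) ?_)
    · rw [Finset.card_disjSum, Finset.card_univ, Fintype.card_fin, ← Nat.sub_le_iff_le_add',
        Nat.le_div_iff_mul_le (by omega), Nat.sub_mul, mul_comm, mul_comm _ d]
      omega
    · intro x hx
      rw [Finset.mem_biUnion]
      rcases x with s | i
      · rw [Finset.inl_mem_disjSum, Finset.mem_filter] at hx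
        obtain ⟨hs, K, hK, v, hv, hadj⟩ := hx
        obtain ⟨K', hK', rfl⟩ := Finset.mem_map.1 hK
        exact ⟨K', hK', Finset.inl_mem_disjSum.2 (Finset.mem_filter.2 ⟨hs, v, hv, hadj⟩)⟩
      · exact ⟨K₀, hK₀, Finset.inr_mem_disjSum.2 (Finset.mem_univ _)⟩)
  have hB : ∀ K : {K | ∃ (hK : K ∈ P₀) (s : V), g ⟨K, hK⟩ = .inl s},
      ∃ s : S, ∃ hK : K.1 ∈ P₀, g ⟨K.1, hK⟩ = .inl s.1 := by
    rintro ⟨K, hK, s, hs⟩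
    have := hg' ⟨K, hK⟩
    rw [hs, Finset.inl_mem_disjSum, Finset.mem_filter] at this
    exact ⟨⟨s, this.1⟩, hK, hs⟩
  choose g' hg₁ hg₂ using hB
  refine ⟨_, g', ?_, ?_, ?_⟩
  · intro K L hKL
    have h1 := hg₂ K
    rw [hKL, ← hg₂ L] at h1
    exact Subtype.ext (Subtype.mk.inj (hg h1))
  · intro K
    have := hg' ⟨K.1, hg₁ K⟩
    rw [hg₂ K, Finset.inl_mem_disjSum, Finset.mem_filter] at this
    exact ⟨(Finset.mem_filter.1 (hg₁ K)).1, this.2⟩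
  · intro T hTP hT
    have hT₀ : ∀ K ∈ T, K ∈ P₀ := fun K hK => Finset.mem_filter.2 ⟨hTP hK, (hT K hK).1⟩
    have hi : ∀ K : T, ∃ i, g ⟨K.1, hT₀ K.1 K.2⟩ = .inr i := by
      intro K
      rcases hgK : g ⟨K.1, hT₀ K.1 K.2⟩ with s | i
      · exact ((hT K.1 K.2).2 ⟨hT₀ K.1 K.2, s, hgK⟩).elim
      · exact ⟨i, rfl⟩
    choose i hi using hi
    have hinj : Function.Injective i := by
      intro K L hKL
      have h1 := hi K
      rw [hKL, ← hi L] at h1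
      exact Subtype.ext (Subtype.mk.inj (hg h1))
    simpa using Fintype.card_le_of_injective i hinj

/-- A node of `S` is joined to a neighbour in its piece, whose remaining nodes are matched by
factor-criticality. Only unpackable pieces left without a partner lose a node, one each, and there
are at most `q / d` of them because the combined matching covers `B`. -/
theorem exists_isPackable_card {d : ℕ} (hd : 3 ≤ d)
    (hdeg : ∀ v, G.degree v = d ∨ G.degree v = d - 1) :
    ∃ W, G.IsPackable W ∧ Fintype.card V
      ≤ W.card + (Finset.univ.filter fun v => G.degree v = d - 1).card / d := by
  classical
  obtain ⟨S, P, hSP, hfc, ⟨m, hm⟩, f, hf, hf'⟩ := exists_isBarrier G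
  obtain ⟨B, g, hg, hg', hT⟩ := hSP.exists_matching_of_unpackable hfc hd hdeg
  obtain ⟨h, hh, hh', hBh⟩ := exists_injective_and_subset_range
    (fun (s : S) (K : Finset V) => K ∈ P ∧ ∃ v ∈ K, G.Adj s.1 v) hf hf' hg hg'
  -- `φ K` is the part of `K` covered when `K` has no partner in `S`.
  have hφ : ∀ K, ∃ φ : Finset V, K ∈ P → φ ⊆ K ∧ G.IsPackable φ ∧ (K \ φ).card ≤ 1 ∧
      (G.IsPackable K → φ = K) := by
    intro K
    by_cases hp : G.IsPackable K
    · exact ⟨K, fun _ => ⟨subset_rfl, hp, by simp, fun _ => rfl⟩⟩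
    by_cases hK : K ∈ P
    · obtain ⟨c, hc⟩ := Finset.card_pos.1 (hSP.odd K hK).pos
      obtain ⟨m, hm⟩ := hfc K hK c hc
      refine ⟨K.erase c, fun _ => ⟨Finset.erase_subset _ _, hm.isPackable, ?_,
        fun h => (hp h).elim⟩⟩
      rw [Finset.sdiff_erase_self hc, Finset.card_singleton]
    · exact ⟨K, fun h => (hK h).elim⟩
  choose φ hφ using hφ
  let P' := P.filter fun K => K ∉ Set.range h
  let W₁ := (Finset.univ : Finset S).biUnion fun s => insert s.1 (h s)
  let W₂ := P'.biUnion φ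
  have hsS : ∀ s : S, ∀ K ∈ P, s.1 ∉ K := fun s K hK hs =>
    Finset.disjoint_left.1 (hSP.disjoint K hK) hs s.2
  have hW₁ : G.IsPackable W₁ := by
    refine IsPackable.biUnion _ _ (fun s _ => ?_) fun s _ s' _ hne => ?_
    · obtain ⟨hK, v, hv, hadj⟩ := hh' s
      obtain ⟨m', hm'⟩ := hfc _ hK v hv
      have : insert s.1 (h s) = {s.1, v} ∪ (h s).erase v := by
        conv_lhs => rw [← Finset.insert_erase hv]
        ext x
        simp
      rw [this]
      refine (IsPackable.of_adj hadj).union hm'.isPackable ?_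
      rw [Finset.disjoint_insert_left, Finset.disjoint_singleton_left]
      exact ⟨fun hs => hsS s _ hK (Finset.mem_of_mem_erase hs), by simp⟩
    · rw [Finset.disjoint_insert_left, Finset.mem_insert, Finset.disjoint_insert_right]
      exact ⟨not_or.2 ⟨fun h => hne (Subtype.ext h), hsS s _ (hh' s').1⟩, hsS s' _ (hh' s).1,
        hSP.pairwise _ (hh' s).1 _ (hh' s').1 fun h => hne (hh h)⟩
  have hP' : ∀ K ∈ P', K ∈ P ∧ ∀ s, h s ≠ K := by
    intro K hK
    rw [Finset.mem_filter] at hK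
    exact ⟨hK.1, fun s hs => hK.2 ⟨s, hs⟩⟩
  have hW₂ : G.IsPackable W₂ := by
    refine IsPackable.biUnion _ _ (fun K hK => (hφ K (hP' K hK).1).2.1) fun K hK L hL hne => ?_
    exact (hSP.pairwise K (hP' K hK).1 L (hP' L hL).1 hne).mono (hφ K (hP' K hK).1).1
      (hφ L (hP' L hL).1).1
  have hW₁₂ : Disjoint W₁ W₂ := by
    rw [Finset.disjoint_biUnion_left]
    intro s _
    rw [Finset.disjoint_biUnion_right]
    intro K hK
    obtain ⟨hKP, hKh⟩ := hP' K hK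
    refine Disjoint.mono_right (hφ K hKP).1 ?_
    rw [Finset.disjoint_insert_left]
    exact ⟨hsS s K hKP, hSP.pairwise _ (hh' s).1 K hKP (hKh s)⟩
  have hsub : W₁ ∪ W₂ ⊆ S ∪ P.biUnion id := by
    refine Finset.union_subset (Finset.biUnion_subset.2 fun s _ => Finset.insert_subset ?_ ?_)
      (Finset.biUnion_subset.2 fun K hK => ?_)
    · exact Finset.mem_union_left _ s.2
    · exact (Finset.subset_biUnion_of_mem id (hh' s).1).trans Finset.subset_union_right
    · exact (hφ K (hP' K hK).1).1.trans ((Finset.subset_biUnion_of_mem id (hP' K hK).1).trans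
        Finset.subset_union_right)
  refine ⟨(W₁ ∪ W₂) ∪ (Finset.univ \ (S ∪ P.biUnion id)),
    (hW₁.union hW₂ hW₁₂).union hm.isPackable (Finset.disjoint_sdiff.mono_left hsub), ?_⟩
  obtain ⟨W, hW⟩ : ∃ W, W = (W₁ ∪ W₂) ∪ (Finset.univ \ (S ∪ P.biUnion id)) := ⟨_, rfl⟩
  rw [← hW, ← Finset.card_add_card_compl W]
  -- Each uncovered node is the one lost by an unpackable piece without a partner.
  refine Nat.add_le_add_left (le_trans ?_ (hT (P'.filter fun K => ¬ G.IsPackable K)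
    (fun K hK => (hP' K (Finset.mem_filter.1 hK).1).1) ?_)) _
  · refine le_trans (Finset.card_le_card (t := (P'.filter fun K => ¬ G.IsPackable K).biUnion
      fun K => K \ φ K) ?_) (le_of_le_of_eq (Finset.card_biUnion_le_card_mul _ _ 1 fun K hK =>
        (hφ K (hP' K (Finset.mem_filter.1 hK).1).1).2.2.1) (mul_one _))
    intro v hv
    rw [Finset.mem_compl, hW, Finset.mem_union, Finset.mem_union, not_or, not_or,
      Finset.mem_sdiff, not_and, not_not] at hv
    obtain ⟨⟨hv₁, hv₂⟩, hv⟩ := hv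
    rcases Finset.mem_union.1 (hv (Finset.mem_univ v)) with hvS | hvP
    · exact (hv₁ (Finset.mem_biUnion.2 ⟨⟨v, hvS⟩, by simp⟩)).elim
    · obtain ⟨K, hK, hvK⟩ := Finset.mem_biUnion.1 hvP
      have hKP' : K ∈ P' := by
        refine Finset.mem_filter.2 ⟨hK, ?_⟩
        rintro ⟨s, rfl⟩
        exact hv₁ (Finset.mem_biUnion.2 ⟨s, Finset.mem_univ _, Finset.mem_insert_of_mem hvK⟩)
      have hvφ : v ∉ φ K := fun h => hv₂ (Finset.mem_biUnion.2 ⟨K, hKP', h⟩)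
      refine Finset.mem_biUnion.2 ⟨K, Finset.mem_filter.2 ⟨hKP', fun hp => ?_⟩,
        Finset.mem_sdiff.2 ⟨hvK, hvφ⟩⟩
      rw [(hφ K hK).2.2.2 hp] at hvφ
      exact hvφ hvK
  · intro K hK
    rw [Finset.mem_filter] at hK
    refine ⟨hK.2, fun hKB => ?_⟩
    obtain ⟨s, hs⟩ := hBh hKB
    exact (hP' K hK.1).2 s hs

end

end SimpleGraph

theorem mainTheorem4 {V : Type*} [Fintype V] [DecidableEq V] (G : SimpleGraph V)
    [DecidableRel G.Adj] (n q d : ℕ) (hd : 3 ≤ d) (hn : Fintype.card V = n)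
    (hdeg : (Finset.univ.filter (fun v : V => G.degree v = d)).card = n - q)
    (hdeg' : (Finset.univ.filter (fun v : V => G.degree v = d - 1)).card = q) :
    ∃ x : Sym2 V → ℕ, G.IsTwoMatching x ∧ G.IsBasicTwoMatching x ∧
      G.IsTriangleFreeTwoMatching x ∧
      (n : ℝ) - (q : ℝ) / (d : ℝ) ≤ (G.twoMatchingSize x : ℝ) := by
  have hdegree : ∀ v, G.degree v = d ∨ G.degree v = d - 1 := by
    -- With `n - q` a truncated subtraction, this is needed for the two degree classes to add up to
    -- `n`.
    have hqn : q ≤ n := by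
      rw [← hdeg', ← hn]
      exact Finset.card_le_univ _
    have hunion : (Finset.univ.filter fun v : V => G.degree v = d)
        ∪ (Finset.univ.filter fun v : V => G.degree v = d - 1) = Finset.univ := by
      rw [← Finset.card_eq_iff_eq_univ, Finset.card_union_of_disjoint, hdeg, hdeg', hn]
      · omega
      · rw [Finset.disjoint_filter]
        intro v _ h
        omega
    intro v
    have hv := Finset.mem_univ v
    rw [← hunion] at hv
    simpa using hv
  obtain ⟨W, hW, hcard⟩ := SimpleGraph.exists_isPackable_card hd hdegree
  obtain ⟨x, h1, h2, h3, h4⟩ := hW.exists_twoMatching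
  refine ⟨x, h1, h2, h3, ?_⟩
  rw [hdeg', hn] at hcard
  rw [h4, sub_le_iff_le_add]
  calc (n : ℝ) ≤ ((W.card + q / d : ℕ) : ℝ) := by exact_mod_cast hcard
    _ = W.card + ((q / d : ℕ) : ℝ) := by push_cast; rfl
    _ ≤ W.card + (q : ℝ) / d := by gcongr; exact Nat.cast_div_le
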